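/- Let $a=\frac{r}{s}\in\mathbb{Q}$ with $r,s\in\mathbb{Z}$, $s>0$ and $\gcd(r,s)=1$, let $c=-1+a-a^2$, and let $f(x)=x^2+c$. Suppose that $a-c$ is not a square in $\mathbb{Q}$ and that at least one of the following holds: 1. $r=1$ and $s>2$ is even; 2. $r=2$, $s>3$, and $s\equiv 1 \pmod 3$; 3. $r=2$ and $s$ is divisible by a prime $q$ with $q\equiv 3\pmod 4$. Let $T$ be the rooted graph whose vertices at level $n\ge 0$ are the elements of $f^{-n}(a)=\{\beta\in\overline{\mathbb{Q}} : f^n(\beta)=a\}$, where $f^n$ is the $n$-th iterate of $f$, whose root is $a$ at level $0$, and in which each $\beta$ at level $n+1$ is joined to $f(\beta)$ at level $n$. Then $T$ is isomorphic, as a rooted graph, to the infinite regular binary rooted tree, and the arboreal Galois representation $$\operatorname{Gal}(\overline{\mathbb{Q}}/\mathbb{Q})\longrightarrow \operatorname{Aut}(T),$$ in which $\sigma$ sends the vertex $\beta$ at level $n$ to $\sigma(\beta)$ at level $n$, is surjective. Here $\operatorname{Aut}(T)$ is the group of graph automorphisms of $T$ that fix the root. -/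

import Mathlib

open Polynomial

/-! ### Rooted graphs and their automorphisms -/

/-- The automorphism group of the graph `G` rooted at `o`: the group, under composition, of
the graph automorphisms of `G` that fix `o`. -/
def RootedAut {V : Type*} (G : SimpleGraph V) (o : V) : Subgroup (G ≃g G) where
  carrier := {φ | φ o = o}
  one_mem' := rfl
  mul_mem' := by
    intro φ ψ hφ hψ
    change φ (ψ o) = o
    rw [show ψ o = o from hψ]
    exact hφ
  inv_mem' := by
    intro φ hφ
    change φ.symm o = o
    rw [RelIso.symm_apply_eq]
    exact (show φ o = o from hφ).symm

/-- The infinite regular `d`-ary rooted tree. Its vertices are the finite words over an alphabet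
with `d` letters, its root is the empty word `[]`, and the `d` children of a word `w` are the words
`i :: w`. -/
def regularTree (d : ℕ) : SimpleGraph (List (Fin d)) where
  Adj u v := (∃ i, u = i :: v) ∨ (∃ i, v = i :: u)
  symm := ⟨fun _ _ h => h.symm⟩
  loopless := ⟨fun u h => by
    rcases h with ⟨i, hi⟩ | ⟨i, hi⟩ <;> simpa using congrArg List.length hi⟩

/-! ### The tree of iterated preimages and the arboreal representation -/

section Arboreal

variable {K : Type*} [Field K]

/-- The self-map `β ↦ f(β)` of the algebraic closure of `K`. -/
noncomputable def polyMap (f : K[X]) (β : AlgebraicClosure K) : AlgebraicClosure K :=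
  aeval β f

/-- The nodes of the backward orbit of `a` under `f`: a node at level `n` is an element `β` of
`f^{-n}(a)`, that is, an element of the algebraic closure with `f^n(β) = a`, where `f^n` is the
`n`-th iterate. -/
@[ext] structure BackwardOrbit (f : K[X]) (a : K) where
  /-- the level of the node in the tree -/
  level : ℕ
  /-- the element of the algebraic closure at this node -/
  val : AlgebraicClosure K
  iterate_eq : (polyMap f)^[level] val = algebraMap K (AlgebraicClosure K) a

variable (f : K[X]) (a : K)

/-- The root of the backward orbit: the point `a` itself, at level `0`. -/
noncomputable def backwardRoot : BackwardOrbit f a where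
  level := 0
  val := algebraMap K (AlgebraicClosure K) a
  iterate_eq := rfl

/-- The graph on the backward orbit: an edge joins each `β` at level `n + 1` to `f(β)` at
level `n`. -/
def backwardTree : SimpleGraph (BackwardOrbit f a) where
  Adj u v := (u.level = v.level + 1 ∧ polyMap f u.val = v.val) ∨
    (v.level = u.level + 1 ∧ polyMap f v.val = u.val)
  symm := ⟨fun _ _ h => h.symm⟩
  loopless := ⟨fun u h => by rcases h with ⟨h, _⟩ | ⟨h, _⟩ <;> omega⟩

variable {f a}

lemma polyMap_galois (σ : Gal(AlgebraicClosure K/K)) (β : AlgebraicClosure K) :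
    polyMap f (σ β) = σ (polyMap f β) :=
  Polynomial.aeval_algHom_apply σ β f

lemma polyMap_iterate_galois (σ : Gal(AlgebraicClosure K/K)) (n : ℕ) (β : AlgebraicClosure K) :
    (polyMap f)^[n] (σ β) = σ ((polyMap f)^[n] β) := by
  induction n generalizing β with
  | zero => rfl
  | succ n ih => rw [Function.iterate_succ_apply, Function.iterate_succ_apply,
      polyMap_galois, ih]

/-- The action of a Galois automorphism on the nodes: `β` at level `n` goes to `σ(β)` at
level `n`. -/
noncomputable def galoisNode (σ : Gal(AlgebraicClosure K/K)) (u : BackwardOrbit f a) : BackwardOrbit f a where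
  level := u.level
  val := σ u.val
  iterate_eq := by rw [polyMap_iterate_galois, u.iterate_eq, AlgEquiv.commutes]

/-- The automorphism of the backward orbit tree given by a Galois automorphism. -/
noncomputable def galoisTreeAut (σ : Gal(AlgebraicClosure K/K)) : backwardTree f a ≃g backwardTree f a where
  toFun := galoisNode σ
  invFun := galoisNode σ.symm
  left_inv u := by ext <;> simp [galoisNode]
  right_inv u := by ext <;> simp [galoisNode]
  map_rel_iff' := by
    intro u v
    simp [backwardTree, galoisNode, polyMap_galois]

variable (f a)

/-- The arboreal Galois representation attached to the backward orbit of `a` under `f`: the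
homomorphism from the absolute Galois group of `K` to the automorphism group of the rooted tree of
iterated preimages of `a`. -/
noncomputable def arborealRepresentation :
    Gal(AlgebraicClosure K/K) →* RootedAut (backwardTree f a) (backwardRoot f a) where
  toFun σ := ⟨galoisTreeAut σ, by
    change galoisNode σ (backwardRoot f a) = backwardRoot f a
    ext <;> simp [galoisNode, backwardRoot]⟩
  map_one' := rfl
  map_mul' _ _ := rfl

end Arboreal

/-!
Write `f = x ^ 2 + c` and let `X n` be level `n` of the backward orbit of `a`. Passing from level
`n` to level `n + 1` adjoins the square roots of `β - c` for `β ∈ X n`, and the product of these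
`β - c` is `critDisc a c n`, that is `± (f^{n+1}(0) - a)`. The proof is Stoll's criterion
(independence of the `critDisc a c n` modulo squares implies surjectivity) followed by a
verification of this independence.

*The criterion.* Surjectivity amounts to realizing, for every `n`, every pattern of signs on the
square roots of `β - c`, `β ∈ X n`, by automorphisms fixing level `n` (`RealizesSigns`); a
compactness argument then passes from finite levels to the whole tree. The realized patterns form
a subspace of `X n → 𝔽₂` stable under the Galois group, which acts on `X n` transitively and
through a 2-group. By `submodule_eq_top_of_transitive` this subspace is everything unless all its
vectors have coordinate sum zero, which would mean that the square root `critRoot a c n` of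
`critDisc a c n` is fixed by all automorphisms fixing level `n`. But quadratic characters that are
trivial on the automorphisms fixing level `n` are products of those of `critRoot a c i` with
`i < n` (`exists_mul_prod_critRoot_eq`), since a Galois-invariant functional on `X i → 𝔽₂` is zero or
the coordinate sum. So `critDisc a c n` would be dependent on the previous ones modulo squares.

*Independence.* For `c = -1 + a - a ^ 2` one has `a ↦ a - 1 ↦ -a ↦ a - 1` under `f`. Hence, with
`a = r / s`, a prime dividing the numerators of both `a - f^{n+1}(0)` and `a - f^{m+1}(0)`,
`n < m`, divides `2 * r`, so it is `2`; and the powers of `2` in these numerators are `1` or `4`. As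
`a - f^{n+1}(0) > 0` for `0 < a ≤ 1`, a dependency modulo squares would make one of these numerators
a square. That is excluded for `n = 0` by the hypothesis on `a - c`, and for `n ≥ 1` by reduction
modulo `4`, `3` or `q` in the three cases.
-/

/-! ### Levels of the backward orbit of a quadratic polynomial -/

section Tree

variable {K : Type*} [Field K]

lemma polyMap_quadratic (c : K) (β : AlgebraicClosure K) :
    polyMap (X ^ 2 + C c) β = β ^ 2 + algebraMap K (AlgebraicClosure K) c := by
  simp [polyMap]

/-- A chosen square root of `β - c`, that is, one of the two preimages of `β` under `x ^ 2 + c`. -/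
noncomputable def sqrtSub (c : K) (β : AlgebraicClosure K) : AlgebraicClosure K :=
  (IsAlgClosed.exists_pow_nat_eq (β - algebraMap K (AlgebraicClosure K) c) two_pos).choose

lemma sqrtSub_sq (c : K) (β : AlgebraicClosure K) :
    sqrtSub c β ^ 2 = β - algebraMap K (AlgebraicClosure K) c :=
  (IsAlgClosed.exists_pow_nat_eq (β - algebraMap K (AlgebraicClosure K) c) two_pos).choose_spec

@[simp] lemma polyMap_sqrtSub (c : K) (β : AlgebraicClosure K) :
    polyMap (X ^ 2 + C c) (sqrtSub c β) = β := by
  rw [polyMap_quadratic, sqrtSub_sq, sub_add_cancel]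

@[simp] lemma polyMap_neg (c : K) (β : AlgebraicClosure K) :
    polyMap (X ^ 2 + C c) (-β) = polyMap (X ^ 2 + C c) β := by
  simp [polyMap_quadratic]

lemma polyMap_eq_iff (c : K) {x y : AlgebraicClosure K} :
    polyMap (X ^ 2 + C c) x = polyMap (X ^ 2 + C c) y ↔ x = y ∨ x = -y := by
  rw [polyMap_quadratic, polyMap_quadratic, add_left_inj, sq_eq_sq_iff_eq_or_eq_neg]

lemma polyMap_eq_iff_sqrtSub (c : K) {x β : AlgebraicClosure K} :
    polyMap (X ^ 2 + C c) x = β ↔ x = sqrtSub c β ∨ x = -sqrtSub c β := by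
  conv_lhs => rw [← polyMap_sqrtSub c β]
  exact polyMap_eq_iff c

open Classical in
/-- The `n`-th level `f^{-n}(a)` of the backward orbit of `a` under `f = x ^ 2 + c`, as a finite
set. -/
noncomputable def levelSet (a c : K) : ℕ → Finset (AlgebraicClosure K)
  | 0 => {algebraMap K (AlgebraicClosure K) a}
  | n + 1 => (levelSet a c n).biUnion fun β => {sqrtSub c β, -sqrtSub c β}

lemma mem_levelSet_zero {a c : K} {β : AlgebraicClosure K} :
    β ∈ levelSet a c 0 ↔ β = algebraMap K (AlgebraicClosure K) a := by
  simp [levelSet]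

lemma mem_levelSet_succ {a c : K} {n : ℕ} {β : AlgebraicClosure K} :
    β ∈ levelSet a c (n + 1) ↔ polyMap (X ^ 2 + C c) β ∈ levelSet a c n := by
  classical
  rw [levelSet, Finset.mem_biUnion]
  constructor
  · rintro ⟨γ, hγ, h⟩
    rw [Finset.mem_insert, Finset.mem_singleton, ← polyMap_eq_iff_sqrtSub] at h
    rwa [h]
  · intro h
    refine ⟨_, h, ?_⟩
    rw [Finset.mem_insert, Finset.mem_singleton, ← polyMap_eq_iff_sqrtSub]

lemma mem_levelSet {a c : K} {n : ℕ} {β : AlgebraicClosure K} :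
    β ∈ levelSet a c n ↔
      (polyMap (X ^ 2 + C c))^[n] β = algebraMap K (AlgebraicClosure K) a := by
  induction n generalizing β with
  | zero => exact mem_levelSet_zero
  | succ n ih => rw [mem_levelSet_succ, ih, Function.iterate_succ_apply]

lemma sqrtSub_mem_levelSet {a c : K} {n : ℕ} {β : AlgebraicClosure K}
    (hβ : β ∈ levelSet a c n) : sqrtSub c β ∈ levelSet a c (n + 1) := by
  rwa [mem_levelSet_succ, polyMap_sqrtSub]

lemma map_mem_levelSet {a c : K} {n : ℕ} (σ : Gal(AlgebraicClosure K/K))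
    {β : AlgebraicClosure K} (hβ : β ∈ levelSet a c n) : σ β ∈ levelSet a c n := by
  rw [mem_levelSet] at hβ ⊢
  rw [polyMap_iterate_galois, hβ, AlgEquiv.commutes]

/-- Evaluating `f ^ n` at an element of the base field. -/
lemma polyMap_iterate_algebraMap (c x : K) (n : ℕ) :
    (polyMap (X ^ 2 + C c))^[n] (algebraMap K (AlgebraicClosure K) x) =
      algebraMap K (AlgebraicClosure K) ((fun y => y ^ 2 + c)^[n] x) := by
  induction n generalizing x with
  | zero => rfl
  | succ n ih =>
    rw [Function.iterate_succ_apply, Function.iterate_succ_apply, polyMap_quadratic, ← map_pow,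
      ← map_add, ih]

/-- No iterate `f^{n+1}(0)` of the critical point of `f = x ^ 2 + c` equals `a`; equivalently, every
element of the backward orbit of `a` has two distinct preimages. -/
def CriticalFree (a c : K) : Prop := ∀ n : ℕ, (fun y => y ^ 2 + c)^[n + 1] 0 ≠ a

lemma sqrtSub_ne_zero {a c : K} (h : CriticalFree a c) {n : ℕ} {β : AlgebraicClosure K}
    (hβ : β ∈ levelSet a c n) : sqrtSub c β ≠ 0 := by
  intro h0
  have h1 := mem_levelSet.1 (sqrtSub_mem_levelSet hβ)
  rw [h0, ← map_zero (algebraMap K (AlgebraicClosure K)), polyMap_iterate_algebraMap] at h1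
  exact h n ((algebraMap K (AlgebraicClosure K)).injective h1)

lemma sqrtSub_ne_neg [CharZero K] {a c : K} (h : CriticalFree a c) {n : ℕ}
    {β : AlgebraicClosure K} (hβ : β ∈ levelSet a c n) : sqrtSub c β ≠ -sqrtSub c β := by
  have : CharZero (AlgebraicClosure K) :=
    charZero_of_injective_algebraMap (algebraMap K (AlgebraicClosure K)).injective
  rw [Ne, self_eq_neg]
  exact sqrtSub_ne_zero h hβ

lemma disjoint_sqrtSub_pairs [DecidableEq (AlgebraicClosure K)] (c : K)
    {β γ : AlgebraicClosure K} (hne : β ≠ γ) :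
    Disjoint ({sqrtSub c β, -sqrtSub c β} : Finset (AlgebraicClosure K))
      {sqrtSub c γ, -sqrtSub c γ} := by
  rw [Finset.disjoint_left]
  intro x hx hy
  rw [Finset.mem_insert, Finset.mem_singleton, ← polyMap_eq_iff_sqrtSub] at hx hy
  exact hne (hx.symm.trans hy)

/-- A product over level `n + 1` groups into pairs of opposite elements indexed by level `n`. -/
lemma prod_levelSet_succ [CharZero K] {M : Type*} [CommMonoid M] {a c : K}
    (h : CriticalFree a c) (n : ℕ) (g : AlgebraicClosure K → M) :
    ∏ γ ∈ levelSet a c (n + 1), g γ =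
      ∏ β ∈ levelSet a c n, g (sqrtSub c β) * g (-sqrtSub c β) := by
  classical
  rw [levelSet, Finset.prod_biUnion fun β _ γ _ hne => disjoint_sqrtSub_pairs c hne]
  exact Finset.prod_congr rfl fun β hβ => Finset.prod_pair (sqrtSub_ne_neg h hβ)

lemma card_levelSet [CharZero K] {a c : K} (h : CriticalFree a c) (n : ℕ) :
    (levelSet a c n).card = 2 ^ n := by
  classical
  induction n with
  | zero => simp [levelSet]
  | succ n ih =>
    rw [levelSet, Finset.card_biUnion fun β _ γ _ hne => disjoint_sqrtSub_pairs c hne,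
      Finset.sum_congr rfl fun β hβ => Finset.card_pair (sqrtSub_ne_neg h hβ),
      Finset.sum_const, ih, smul_eq_mul, pow_succ]

lemma prod_sub_levelSet [CharZero K] {a c : K} (h : CriticalFree a c) (n : ℕ)
    (x : AlgebraicClosure K) :
    ∏ β ∈ levelSet a c n, (x - β) =
      (polyMap (X ^ 2 + C c))^[n] x - algebraMap K (AlgebraicClosure K) a := by
  induction n generalizing x with
  | zero => simp [levelSet]
  | succ n ih =>
    rw [prod_levelSet_succ h, Function.iterate_succ_apply, ← ih]
    refine Finset.prod_congr rfl fun β _ => ?_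
    rw [polyMap_quadratic]
    linear_combination - sqrtSub_sq c β

/-- The product of `β - c` over all `β` in level `n`, as an element of the base field. It is
`a - f(0)` for `n = 0` and `f^{n+1}(0) - a` for `n ≥ 1`. -/
def critDisc (a c : K) (n : ℕ) : K := (-1) ^ 2 ^ n * ((fun y => y ^ 2 + c)^[n + 1] 0 - a)

/-- The product of the chosen square roots of `β - c` over all `β` in level `n`; a square root of
`critDisc a c n`. -/
noncomputable def critRoot (a c : K) (n : ℕ) : AlgebraicClosure K :=
  ∏ β ∈ levelSet a c n, sqrtSub c β

lemma critRoot_sq [CharZero K] {a c : K} (h : CriticalFree a c) (n : ℕ) :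
    critRoot a c n ^ 2 = algebraMap K (AlgebraicClosure K) (critDisc a c n) := by
  have h1 := prod_sub_levelSet h n (algebraMap K (AlgebraicClosure K) c)
  rw [polyMap_iterate_algebraMap, ← map_sub] at h1
  rw [critRoot, ← Finset.prod_pow, critDisc, map_mul, Function.iterate_succ_apply]
  rw [zero_pow two_ne_zero, zero_add, ← h1, map_pow, map_neg, map_one, ← card_levelSet h n,
    ← Finset.prod_const, ← Finset.prod_mul_distrib]
  refine Finset.prod_congr rfl fun β _ => ?_
  rw [sqrtSub_sq]; ring

lemma critRoot_ne_zero {a c : K} (h : CriticalFree a c) (n : ℕ) : critRoot a c n ≠ 0 :=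
  Finset.prod_ne_zero_iff.2 fun _ hβ => sqrtSub_ne_zero h hβ

/-! ### The backward orbit as a binary tree -/

/-- The node of the backward orbit addressed by a word: `0` selects the chosen square root and `1`
its negative. -/
noncomputable def nodeVal (a c : K) : List (Fin 2) → AlgebraicClosure K
  | [] => algebraMap K (AlgebraicClosure K) a
  | i :: w => if i = 0 then sqrtSub c (nodeVal a c w) else -sqrtSub c (nodeVal a c w)

@[simp] lemma polyMap_nodeVal_cons (a c : K) (i : Fin 2) (w : List (Fin 2)) :
    polyMap (X ^ 2 + C c) (nodeVal a c (i :: w)) = nodeVal a c w := by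
  rw [nodeVal]; split_ifs <;> simp

lemma nodeVal_mem_levelSet (a c : K) (w : List (Fin 2)) :
    nodeVal a c w ∈ levelSet a c w.length := by
  induction w with
  | nil => simp [nodeVal, levelSet]
  | cons i w ih => rwa [List.length_cons, mem_levelSet_succ, polyMap_nodeVal_cons]

lemma nodeVal_injective_of_length [CharZero K] {a c : K} (h : CriticalFree a c)
    (v w : List (Fin 2)) (hl : v.length = w.length) (he : nodeVal a c v = nodeVal a c w) :
    v = w := by
  induction v generalizing w with
  | nil => exact (List.length_eq_zero_iff.1 hl.symm).symm
  | cons i v ih =>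
    cases w with
    | nil => simp at hl
    | cons j w =>
      have hv : v = w := ih w (by simpa using hl) (by
        rw [← polyMap_nodeVal_cons a c i v, he, polyMap_nodeVal_cons])
      subst hv
      have hne := sqrtSub_ne_neg h (nodeVal_mem_levelSet a c v)
      simp only [nodeVal] at he
      have hij : i = j := by
        split_ifs at he with h1 h2 h2
        · rw [h1, h2]
        · exact absurd he hne
        · exact absurd he.symm hne
        · omega
      rw [hij]

lemma exists_nodeVal_eq (a c : K) (n : ℕ) (β : AlgebraicClosure K) (hβ : β ∈ levelSet a c n) :
    ∃ w : List (Fin 2), w.length = n ∧ nodeVal a c w = β := by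
  induction n generalizing β with
  | zero => exact ⟨[], rfl, (mem_levelSet_zero.1 hβ).symm⟩
  | succ n ih =>
    obtain ⟨w, hw, hv⟩ := ih _ (mem_levelSet_succ.1 hβ)
    rcases (polyMap_eq_iff_sqrtSub c).1 (rfl : polyMap (X ^ 2 + C c) β = _) with h | h
    · exact ⟨0 :: w, by simp [hw], by simp [nodeVal, hv, ← h]⟩
    · exact ⟨1 :: w, by simp [hw], by simp [nodeVal, hv, ← h]⟩

/-- The node of the backward orbit at an element of level `n`. -/
noncomputable def nodeOfMem {a c : K} {n : ℕ} {β : AlgebraicClosure K}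
    (hβ : β ∈ levelSet a c n) : BackwardOrbit (X ^ 2 + C c) a :=
  ⟨n, β, mem_levelSet.1 hβ⟩

lemma BackwardOrbit.val_mem_levelSet {a c : K} (u : BackwardOrbit (X ^ 2 + C c) a) :
    u.val ∈ levelSet a c u.level := mem_levelSet.2 u.iterate_eq

/-- If no critical point lies above `a`, the backward orbit is a regular binary rooted tree. -/
theorem exists_backwardTree_iso [CharZero K] {a c : K} (h : CriticalFree a c) :
    ∃ e : backwardTree (X ^ 2 + C c) a ≃g regularTree 2,
      e (backwardRoot (X ^ 2 + C c) a) = [] := by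
  let g : List (Fin 2) → BackwardOrbit (X ^ 2 + C c) a := fun w =>
    nodeOfMem (nodeVal_mem_levelSet a c w)
  have hg : Function.Bijective g := by
    refine ⟨fun v w hvw => ?_, fun u => ?_⟩
    · exact nodeVal_injective_of_length h v w (congrArg BackwardOrbit.level hvw)
        (congrArg BackwardOrbit.val hvw)
    · obtain ⟨w, hw, hv⟩ := exists_nodeVal_eq a c u.level u.val u.val_mem_levelSet
      exact ⟨w, BackwardOrbit.ext hw hv⟩
  have key (v w : List (Fin 2)) :
      ((g v).level = (g w).level + 1 ∧ polyMap (X ^ 2 + C c) (g v).val = (g w).val) ↔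
        ∃ i, v = i :: w := by
    constructor
    · rintro ⟨h1, h2⟩
      cases v with
      | nil => simp [g, nodeOfMem] at h1
      | cons i v =>
        refine ⟨i, ?_⟩
        rw [nodeVal_injective_of_length h v w]
        · simpa [g, nodeOfMem] using h1
        · simpa [g, nodeOfMem] using h2
    · rintro ⟨i, rfl⟩
      simp [g, nodeOfMem]
  let e : regularTree 2 ≃g backwardTree (X ^ 2 + C c) a :=
    { toEquiv := Equiv.ofBijective g hg
      map_rel_iff' := by
        intro v w
        change (_ ∨ _) ↔ (_ ∨ _)
        rw [← key v w, ← key w v]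
        rfl }
  refine ⟨e.symm, ?_⟩
  rw [RelIso.symm_apply_eq]
  rfl

/-! ### Automorphisms of the backward orbit preserve levels -/

/-- The parent `f(β)` of a node above the root. -/
noncomputable def BackwardOrbit.parent {f : K[X]} {a : K} (u : BackwardOrbit f a) {n : ℕ}
    (hu : u.level = n + 1) : BackwardOrbit f a where
  level := n
  val := polyMap f u.val
  iterate_eq := by
    rw [← Function.iterate_succ_apply, Nat.succ_eq_add_one, ← hu, u.iterate_eq]

lemma BackwardOrbit.eq_root_of_level {f : K[X]} {a : K} {u : BackwardOrbit f a}
    (hu : u.level = 0) : u = backwardRoot f a := by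
  have h := u.iterate_eq
  rw [hu] at h
  exact BackwardOrbit.ext hu h

lemma backwardTree_adj_parent {f : K[X]} {a : K} (u : BackwardOrbit f a) {n : ℕ}
    (hu : u.level = n + 1) : (backwardTree f a).Adj u (u.parent hu) :=
  Or.inl ⟨hu, rfl⟩

/-- An automorphism that fixes the root preserves levels: otherwise it would send a child of some
node `p` to the parent of the image of `p`, which is already the image of the parent of `p`. -/
lemma level_apply {f : K[X]} {a : K} (φ : backwardTree f a ≃g backwardTree f a)
    (hφ : φ (backwardRoot f a) = backwardRoot f a) (u : BackwardOrbit f a) :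
    (φ u).level = u.level := by
  suffices H : ∀ n, ∀ u : BackwardOrbit f a, u.level = n → (φ u).level = n from H _ u rfl
  intro n
  induction n using Nat.strong_induction_on with
  | _ n ih =>
    intro u hu
    cases n with
    | zero => rw [BackwardOrbit.eq_root_of_level hu, hφ]; rfl
    | succ n =>
      have hp : (φ (u.parent hu)).level = n := ih n (by omega) _ rfl
      rcases φ.map_rel_iff.2 (backwardTree_adj_parent u hu) with ⟨h1, -⟩ | ⟨h1, h2⟩
      · rw [h1, hp]
      · exfalso
        cases n with
        | zero => omega
        | succ n =>
          have hpl : (u.parent hu).level = n + 1 := rfl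
          have hpp : (φ ((u.parent hu).parent hpl)).level = n := ih n (by omega) _ rfl
          rcases φ.map_rel_iff.2 (backwardTree_adj_parent (u.parent hu) hpl) with
            ⟨h3, h4⟩ | ⟨h3, -⟩
          · have : φ u = φ ((u.parent hu).parent hpl) :=
              BackwardOrbit.ext (by omega) (h2.symm.trans h4)
            have h5 := congrArg BackwardOrbit.level (φ.injective this)
            rw [hu] at h5
            change n + 1 + 1 = n at h5
            omega
          · omega

lemma polyMap_apply_val {f : K[X]} {a : K} (φ : backwardTree f a ≃g backwardTree f a)
    (hφ : φ (backwardRoot f a) = backwardRoot f a) (u : BackwardOrbit f a) {n : ℕ}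
    (hu : u.level = n + 1) : polyMap f (φ u).val = (φ (u.parent hu)).val := by
  rcases φ.map_rel_iff.2 (backwardTree_adj_parent u hu) with ⟨-, h⟩ | ⟨h, -⟩
  · exact h
  · rw [level_apply φ hφ, level_apply φ hφ, hu] at h
    change n = n + 1 + 1 at h
    omega

end Tree

/-! ### Stable subspaces for transitive 2-groups -/

/-- For a 2-group permuting a finite set `X` transitively, the only submodule of `X → 𝔽₂` that is
stable under the action and contains a vector with nonzero coordinate sum is the whole space.
Otherwise the annihilator of `V` is nonzero, so the 2-group fixes a nonzero functional in it, and by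
transitivity this functional is the coordinate sum. -/
theorem submodule_eq_top_of_transitive {G X : Type*} [Group G] [Fintype X] [DecidableEq X]
    (ρ : G →* Equiv.Perm X) (htrans : ∀ x y, ∃ g, ρ g x = y)
    (h2 : ∀ g, ∃ k : ℕ, ρ g ^ 2 ^ k = 1) (V : Submodule (ZMod 2) (X → ZMod 2))
    (hV : ∀ g, ∀ v ∈ V, v ∘ ρ g ∈ V) (hne : ∃ v ∈ V, ∑ x, v x ≠ 0) : V = ⊤ := by
  by_contra hVtop
  obtain ⟨f, hf0, hfV⟩ := Submodule.exists_dual_map_eq_bot_of_lt_top (lt_top_iff_ne_top.2 hVtop)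
    inferInstance
  let W := {w : X → ZMod 2 // ∀ v ∈ V, ∑ x, w x * v x = 0}
  -- the action by permuting coordinates
  let act : MulAction ρ.range W :=
    { smul := fun g w => ⟨w.1 ∘ (g⁻¹ : ρ.range).1, fun v hv => by
        obtain ⟨σ, hσ⟩ := g.2
        refine Eq.trans ?_ (w.2 _ (hV σ v hv))
        refine (Equiv.sum_comp (ρ σ) _).symm.trans (Finset.sum_congr rfl fun x _ => ?_)
        have h : (g⁻¹ : ρ.range).1 (ρ σ x) = x := by rw [hσ]; simp
        simp only [Function.comp_apply, h]⟩
      one_smul := fun w => Subtype.ext (funext fun x => by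
        change w.1 ((1 : ρ.range)⁻¹.1 x) = w.1 x
        simp)
      mul_smul := fun g h w => Subtype.ext (funext fun x => by
        change w.1 ((g * h)⁻¹.1 x) = w.1 (h⁻¹.1 (g⁻¹.1 x))
        simp) }
  have smul_apply (g : ρ.range) (w : W) (x : X) : (g • w).1 x = w.1 (g⁻¹.1 x) := rfl
  have hP : IsPGroup 2 ρ.range := by
    rintro ⟨_, g, rfl⟩
    obtain ⟨k, hk⟩ := h2 g
    exact ⟨k, Subtype.ext hk⟩
  have : Fact (Nat.Prime 2) := ⟨Nat.prime_two⟩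
  have hfw : ∀ v, f v = ∑ x, f (Pi.single x 1) * v x := fun v => by
    conv_lhs => rw [pi_eq_sum_univ' v]
    rw [map_sum]
    refine Finset.sum_congr rfl fun x _ => ?_
    rw [map_smul, smul_eq_mul, mul_comm]
  let w₀ : W := ⟨fun x => f (Pi.single x 1), fun v hv => by
    rw [← hfw]
    have : f v ∈ V.map f := Submodule.mem_map_of_mem hv
    rwa [hfV, Submodule.mem_bot] at this⟩
  let z : W := ⟨0, by simp⟩
  have hw₀ : w₀ ≠ z := fun h => hf0 (LinearMap.ext fun v => by
    rw [hfw]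
    have h' : ∀ x, f (Pi.single x 1) = 0 := fun x => congrFun (congrArg Subtype.val h) x
    simp [h'])
  have hz : z ∈ MulAction.fixedPoints ρ.range W := fun g => rfl
  have hcard : 2 ∣ Nat.card W := by
    -- translation by `w₀` is a fixed-point-free involution of `W`
    let t : W → W := fun w => ⟨w.1 + w₀.1, fun v hv => by
      simp [add_mul, Finset.sum_add_distrib, w.2 v hv, w₀.2 v hv]⟩
    have ht : Function.Involutive t := fun w => Subtype.ext (funext fun x => by
      change w.1 x + w₀.1 x + w₀.1 x = w.1 x
      rw [add_assoc, CharTwo.add_self_eq_zero, add_zero])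
    have hfix : ∀ w, t w ≠ w := fun w h => hw₀ (Subtype.ext (by
      have := congrArg Subtype.val h
      simpa [t, z] using this))
    classical
    rw [Nat.card_eq_fintype_card, ← even_iff_two_dvd]
    by_contra hodd
    rw [Nat.not_even_iff_odd] at hodd
    obtain ⟨w, hw⟩ := Equiv.Perm.exists_fixed_point_of_prime (p := 2) (n := 1) (σ := ht.toPerm)
      (by rwa [← even_iff_two_dvd, Nat.not_even_iff_odd]) (by
        ext w; simp [pow_two, ht w])
    exact hfix w hw
  obtain ⟨w, hw, hwz⟩ := hP.exists_fixed_point_of_prime_dvd_card_of_fixed_point W hcard hz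
  have hconst : ∀ x y, w.1 x = w.1 y := fun x y => by
    obtain ⟨g, rfl⟩ := htrans x y
    have := congrArg (fun w : W => w.1 (ρ g x)) (hw ⟨ρ g, g, rfl⟩)
    simpa [smul_apply] using this
  obtain ⟨v, hv, hv0⟩ := hne
  obtain ⟨x, hx⟩ : ∃ x, w.1 x ≠ 0 := by
    by_contra! h
    exact hwz (Subtype.ext (funext fun x => (h x).symm))
  have h1 := w.2 v hv
  rw [Finset.sum_congr rfl fun y _ => by rw [hconst y x], ← Finset.mul_sum] at h1
  exact (mul_ne_zero hx hv0) h1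

/-! ### Galois action on the square roots over a level -/

section Galois

variable {K : Type*} [Field K]

open Classical in
/-- For `y` with `σ y = ± y`, the sign written additively: `0` if `σ` fixes `y`, and `1` if not. -/
noncomputable def galSign (y : AlgebraicClosure K) (σ : Gal(AlgebraicClosure K/K)) : ZMod 2 :=
  if σ y = y then 0 else 1

lemma galSign_eq_zero_iff {y : AlgebraicClosure K} {σ : Gal(AlgebraicClosure K/K)} :
    galSign y σ = 0 ↔ σ y = y := by
  unfold galSign
  split_ifs with h <;> simp [h]

lemma galSign_one (y : AlgebraicClosure K) : galSign y 1 = 0 := galSign_eq_zero_iff.2 rfl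

/-- The sign `±1` attached to an element of `𝔽₂`. -/
def signOf (R : Type*) [Ring R] (x : ZMod 2) : R := if x = 0 then 1 else -1

lemma zmod_two_cases (x : ZMod 2) : x = 0 ∨ x = 1 := by revert x; decide

lemma signOf_add (R : Type*) [Ring R] (x y : ZMod 2) :
    signOf R (x + y) = signOf R x * signOf R y := by
  rcases zmod_two_cases x with rfl | rfl <;> rcases zmod_two_cases y with rfl | rfl <;>
    simp [signOf, show (1 + 1 : ZMod 2) = 0 by decide]

lemma apply_eq_signOf {y : AlgebraicClosure K} {σ : Gal(AlgebraicClosure K/K)}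
    (h : σ y = y ∨ σ y = -y) : σ y = signOf (AlgebraicClosure K) (galSign y σ) * y := by
  unfold galSign signOf
  split_ifs with h1 h2 h2
  · simp [h1]
  · simp at h2
  · simp at h2
  · simpa using h.resolve_left h1

lemma algebraicClosure_charZero [CharZero K] : CharZero (AlgebraicClosure K) :=
  charZero_of_injective_algebraMap (algebraMap K (AlgebraicClosure K)).injective

lemma galSign_eq_of_apply_eq [CharZero K] {y : AlgebraicClosure K} (hy : y ≠ 0)
    {σ : Gal(AlgebraicClosure K/K)} {x : ZMod 2}
    (h : σ y = signOf (AlgebraicClosure K) x * y) : galSign y σ = x := by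
  have := algebraicClosure_charZero (K := K)
  rcases zmod_two_cases x with rfl | rfl
  · rw [galSign_eq_zero_iff, h]; simp [signOf]
  · rcases zmod_two_cases (galSign y σ) with h1 | h1
    · rw [galSign_eq_zero_iff, h] at h1
      simp [signOf, neg_eq_self, hy] at h1
    · exact h1

lemma galSign_mul [CharZero K] {y : AlgebraicClosure K} (hy : y ≠ 0)
    {σ τ : Gal(AlgebraicClosure K/K)} (hσ : σ y = y ∨ σ y = -y) (hτ : τ y = y ∨ τ y = -y) :
    galSign y (σ * τ) = galSign y σ + galSign y τ := by
  apply galSign_eq_of_apply_eq hy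
  rw [AlgEquiv.mul_apply, apply_eq_signOf hτ, map_mul, signOf_add]
  rw [apply_eq_signOf hσ]
  have : σ (signOf (AlgebraicClosure K) (galSign y τ)) = signOf _ (galSign y τ) := by
    unfold signOf; split_ifs <;> simp
  rw [this]; ring

lemma apply_eq_or_neg_of_sq {y : AlgebraicClosure K} {q : K}
    (hy : y ^ 2 = algebraMap K (AlgebraicClosure K) q) (σ : Gal(AlgebraicClosure K/K)) :
    σ y = y ∨ σ y = -y := by
  rw [← sq_eq_sq_iff_eq_or_eq_neg, ← map_pow, hy, AlgEquiv.commutes]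

lemma galSign_conj_of_sq [CharZero K] {y : AlgebraicClosure K} (hy : y ≠ 0) {q : K}
    (hq : y ^ 2 = algebraMap K (AlgebraicClosure K) q) (σ τ : Gal(AlgebraicClosure K/K)) :
    galSign y (τ⁻¹ * σ * τ) = galSign y σ := by
  have h := apply_eq_or_neg_of_sq hq
  have h1 : galSign y τ⁻¹ + galSign y τ = 0 := by
    rw [← galSign_mul hy (h _) (h _), inv_mul_cancel, galSign_one]
  rw [galSign_mul hy (h _) (h _), galSign_mul hy (h _) (h _), add_right_comm, h1, zero_add]

lemma gal_inv_apply_eq {σ : Gal(AlgebraicClosure K/K)} {x y : AlgebraicClosure K} :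
    σ⁻¹ x = y ↔ x = σ y :=
  σ.toEquiv.symm_apply_eq

/-- The subgroup of the Galois group fixing every element of level `n`. -/
def levelFixing (a c : K) (n : ℕ) : Subgroup Gal(AlgebraicClosure K/K) where
  carrier := {σ | ∀ β ∈ levelSet a c n, σ β = β}
  one_mem' := fun _ _ => rfl
  mul_mem' := fun {σ τ} hσ hτ β hβ => by rw [AlgEquiv.mul_apply, hτ β hβ, hσ β hβ]
  inv_mem' := fun {σ} hσ β hβ => by
    rw [gal_inv_apply_eq, hσ β hβ]

lemma conj_mem_levelFixing {a c : K} {n : ℕ} {σ : Gal(AlgebraicClosure K/K)}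
    (hσ : σ ∈ levelFixing a c n) (τ : Gal(AlgebraicClosure K/K)) :
    τ⁻¹ * σ * τ ∈ levelFixing a c n := fun β hβ => by
  rw [AlgEquiv.mul_apply, AlgEquiv.mul_apply, hσ _ (map_mem_levelSet τ hβ)]
  exact τ.symm_apply_apply β

lemma apply_eq_or_neg_of_polyMap {c : K} {σ : Gal(AlgebraicClosure K/K)}
    {γ : AlgebraicClosure K}
    (h : σ (polyMap (X ^ 2 + C c) γ) = polyMap (X ^ 2 + C c) γ) : σ γ = γ ∨ σ γ = -γ := by
  rwa [← polyMap_eq_iff c, polyMap_galois]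

lemma apply_sqrtSub {a c : K} {n : ℕ} {σ : Gal(AlgebraicClosure K/K)}
    (hσ : σ ∈ levelFixing a c n) {β : AlgebraicClosure K} (hβ : β ∈ levelSet a c n) :
    σ (sqrtSub c β) = sqrtSub c β ∨ σ (sqrtSub c β) = -sqrtSub c β :=
  apply_eq_or_neg_of_polyMap (by rw [polyMap_sqrtSub, hσ β hβ])

lemma galSign_sqrtSub_conj (c : K) (σ τ : Gal(AlgebraicClosure K/K)) (β : AlgebraicClosure K) :
    galSign (sqrtSub c β) (τ⁻¹ * σ * τ) = galSign (sqrtSub c (τ β)) σ := by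
  have h1 : τ (sqrtSub c β) = sqrtSub c (τ β) ∨ τ (sqrtSub c β) = -sqrtSub c (τ β) := by
    rw [← polyMap_eq_iff_sqrtSub, polyMap_galois, polyMap_sqrtSub]
  have h2 : (τ⁻¹ * σ * τ) (sqrtSub c β) = sqrtSub c β ↔
      σ (sqrtSub c (τ β)) = sqrtSub c (τ β) := by
    rw [AlgEquiv.mul_apply, AlgEquiv.mul_apply, gal_inv_apply_eq]
    rcases h1 with h1 | h1 <;> rw [h1]
    rw [map_neg, neg_inj]
  classical
  unfold galSign
  exact if_congr h2 rfl rfl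

/-- The sign of `σ` on `critRoot` is the parity of the number of flipped square roots. -/
lemma galSign_critRoot [CharZero K] {a c : K} (h : CriticalFree a c) {n : ℕ}
    {σ : Gal(AlgebraicClosure K/K)} (hσ : σ ∈ levelFixing a c n) :
    galSign (critRoot a c n) σ = ∑ β ∈ levelSet a c n, galSign (sqrtSub c β) σ := by
  classical
  apply galSign_eq_of_apply_eq (critRoot_ne_zero h n)
  suffices H : ∀ S ⊆ levelSet a c n, σ (∏ β ∈ S, sqrtSub c β) =
      signOf (AlgebraicClosure K) (∑ β ∈ S, galSign (sqrtSub c β) σ) * ∏ β ∈ S, sqrtSub c β from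
    H _ subset_rfl
  intro S
  induction S using Finset.induction_on with
  | empty => intro _; simp [signOf]
  | insert β S hβ ih =>
    intro hS
    rw [Finset.prod_insert hβ, Finset.sum_insert hβ, map_mul, signOf_add,
      ih ((Finset.subset_insert β S).trans hS),
      apply_eq_signOf (apply_sqrtSub hσ (hS (Finset.mem_insert_self β S)))]
    ring

/-- Every pattern of signs on the square roots of `β - c`, for `β` in level `n`, is realized by a
Galois automorphism fixing level `n`: level `n + 1` is as large as possible over level `n`. -/
def RealizesSigns (a c : K) (n : ℕ) : Prop :=
  ∀ v : AlgebraicClosure K → ZMod 2, ∃ σ ∈ levelFixing a c n,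
    ∀ β ∈ levelSet a c n, galSign (sqrtSub c β) σ = v β

/-- The Galois group acts transitively on level `n` if the levels up to it are as large as
possible. -/
lemma exists_apply_eq_of_realizesSigns {a c : K} (n : ℕ)
    (hE : ∀ k < n, RealizesSigns a c k) {β γ : AlgebraicClosure K}
    (hβ : β ∈ levelSet a c n) (hγ : γ ∈ levelSet a c n) :
    ∃ σ : Gal(AlgebraicClosure K/K), σ β = γ := by
  induction n generalizing β γ with
  | zero =>
    rw [mem_levelSet_zero] at hβ hγ
    exact ⟨1, by rw [hβ, hγ]; rfl⟩
  | succ n ih =>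
    obtain ⟨σ, hσ⟩ := ih (fun k hk => hE k (by omega)) (mem_levelSet_succ.1 hβ)
      (mem_levelSet_succ.1 hγ)
    rw [← polyMap_galois, polyMap_eq_iff] at hσ
    rcases hσ with hσ | hσ
    · exact ⟨σ, hσ⟩
    · -- correct the sign by an automorphism negating level `n + 1`
      obtain ⟨τ, hτ, hτs⟩ := hE n (by omega) fun _ => 1
      have hδ := mem_levelSet_succ.1 hγ
      have h1 : τ (sqrtSub c (polyMap (X ^ 2 + C c) γ)) =
          -sqrtSub c (polyMap (X ^ 2 + C c) γ) := by
        refine (apply_sqrtSub hτ hδ).resolve_left fun h => ?_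
        rw [← galSign_eq_zero_iff, hτs _ hδ] at h
        exact one_ne_zero h
      refine ⟨τ * σ, ?_⟩
      rw [AlgEquiv.mul_apply, hσ, map_neg]
      rcases (polyMap_eq_iff_sqrtSub c).1 (rfl : polyMap (X ^ 2 + C c) γ = _) with h | h
      · rw [h.symm] at h1
        rw [h1, neg_neg]
      · rw [← neg_eq_iff_eq_neg] at h
        rwa [← h, map_neg, neg_neg] at h1

/-- Two automorphisms that agree on level `n` and have the same signs agree on level `n + 1`, hence
on everything fixed by `levelFixing a c (n + 1)`. -/
lemma apply_eq_of_galSign_eq {a c : K} {n : ℕ} {w : AlgebraicClosure K}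
    (hw : ∀ σ ∈ levelFixing a c (n + 1), σ w = w) {σ τ : Gal(AlgebraicClosure K/K)}
    (hσ : σ ∈ levelFixing a c n) (hτ : τ ∈ levelFixing a c n)
    (h : ∀ β ∈ levelSet a c n, galSign (sqrtSub c β) σ = galSign (sqrtSub c β) τ) :
    σ w = τ w := by
  have h1 : τ⁻¹ * σ ∈ levelFixing a c (n + 1) := fun γ hγ => by
    rw [AlgEquiv.mul_apply, gal_inv_apply_eq]
    have hβ := mem_levelSet_succ.1 hγ
    have h2 : σ (sqrtSub c (polyMap (X ^ 2 + C c) γ)) =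
        τ (sqrtSub c (polyMap (X ^ 2 + C c) γ)) := by
      rw [apply_eq_signOf (apply_sqrtSub hσ hβ), apply_eq_signOf (apply_sqrtSub hτ hβ), h _ hβ]
    rcases (polyMap_eq_iff_sqrtSub c).1 (rfl : polyMap (X ^ 2 + C c) γ = _) with h | h
    · rw [h, h2]
    · rw [h, map_neg, map_neg, h2]
  have h3 := hw _ h1
  rwa [AlgEquiv.mul_apply, gal_inv_apply_eq] at h3

/-- The quadratic character of `w`, restricted to the automorphisms fixing level `n`, is either
trivial or that of `critRoot a c n` if it is trivial on those fixing level `n + 1`: it is a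
functional of the sign vector, and it takes the same value on all basis vectors because these are
conjugate. -/
lemma exists_galSign_eq_mul [CharZero K] {a c : K} (h : CriticalFree a c) {n : ℕ}
    (hE : ∀ k ≤ n, RealizesSigns a c k) {w : AlgebraicClosure K} (hw0 : w ≠ 0) {q : K}
    (hq : w ^ 2 = algebraMap K (AlgebraicClosure K) q)
    (hw : ∀ σ ∈ levelFixing a c (n + 1), σ w = w) :
    ∃ t : ZMod 2, ∀ σ ∈ levelFixing a c n,
      galSign w σ = t * galSign (critRoot a c n) σ := by
  classical
  have hsign := apply_eq_or_neg_of_sq hq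
  have hcongr : ∀ σ ∈ levelFixing a c n, ∀ τ ∈ levelFixing a c n,
      (∀ β ∈ levelSet a c n, galSign (sqrtSub c β) σ = galSign (sqrtSub c β) τ) →
      galSign w σ = galSign w τ := fun σ hσ τ hτ hs => by
    unfold galSign
    rw [apply_eq_of_galSign_eq hw hσ hτ hs]
  choose s hs hsv using fun β => hE n le_rfl (Pi.single β 1)
  have hconst : ∀ β ∈ levelSet a c n, ∀ γ ∈ levelSet a c n,
      galSign w (s β) = galSign w (s γ) := fun β hβ γ hγ => by
    obtain ⟨τ, rfl⟩ := exists_apply_eq_of_realizesSigns n (fun k hk => hE k hk.le) hβ hγ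
    rw [← galSign_conj_of_sq hw0 hq (s (τ β)) τ]
    refine hcongr _ (hs β) _ (conj_mem_levelFixing (hs _) τ) fun x hx => ?_
    rw [galSign_sqrtSub_conj, hsv _ _ (map_mem_levelSet τ hx), hsv _ _ hx]
    simp [Pi.single_apply]
  obtain ⟨t, ht⟩ : ∃ t, ∀ β ∈ levelSet a c n, galSign w (s β) = t := by
    by_cases hX : (levelSet a c n).Nonempty
    · obtain ⟨γ, hγ⟩ := hX
      exact ⟨_, fun β hβ => hconst β hβ γ hγ⟩
    · exact ⟨0, fun β hβ => (hX ⟨β, hβ⟩).elim⟩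
  have hind : ∀ S ⊆ levelSet a c n, ∀ σ ∈ levelFixing a c n,
      (∀ β ∈ levelSet a c n, galSign (sqrtSub c β) σ = if β ∈ S then 1 else 0) →
      galSign w σ = ∑ _β ∈ S, t := by
    intro S
    induction S using Finset.induction_on with
    | empty =>
      intro _ σ hσ hv
      rw [Finset.sum_empty, ← galSign_one w]
      exact hcongr σ hσ 1 (one_mem _) fun β hβ => by simp [hv β hβ, galSign_one]
    | insert γ S hγ ih =>
      intro hS σ hσ hv
      obtain ⟨τ, hτ, hτv⟩ := hE n le_rfl fun β => if β ∈ S then 1 else 0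
      rw [Finset.sum_insert hγ, ← ih ((Finset.subset_insert γ S).trans hS) τ hτ hτv,
        ← ht γ (hS (Finset.mem_insert_self γ S)), ← galSign_mul hw0 (hsign _) (hsign _)]
      refine hcongr σ hσ _ (mul_mem (hs γ) hτ) fun β hβ => ?_
      rw [galSign_mul (sqrtSub_ne_zero h hβ) (apply_sqrtSub (hs γ) hβ) (apply_sqrtSub hτ hβ),
        hv β hβ, hsv γ β hβ, hτv β hβ, Pi.single_apply]
      by_cases hβγ : β = γ
      · subst hβγ; simp [hγ]
      · simp [hβγ]
  refine ⟨t, fun σ hσ => ?_⟩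
  rw [galSign_critRoot h hσ,
    hind ((levelSet a c n).filter fun β => galSign (sqrtSub c β) σ = 1) (Finset.filter_subset _ _)
      σ hσ fun β hβ => ?_, Finset.sum_filter, Finset.mul_sum]
  · refine Finset.sum_congr rfl fun β _ => ?_
    rcases zmod_two_cases (galSign (sqrtSub c β) σ) with h1 | h1 <;> simp [h1]
  · rcases zmod_two_cases (galSign (sqrtSub c β) σ) with h1 | h1 <;> simp [h1, hβ]

/-- While the levels are as large as possible, every quadratic extension of `K` inside the field
generated by level `n` is generated by a product of the `critRoot a c i` with `i < n`. -/
theorem exists_mul_prod_critRoot_eq [CharZero K] {a c : K} (h : CriticalFree a c) (n : ℕ)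
    (hE : ∀ k < n, RealizesSigns a c k) {w : AlgebraicClosure K} (hw0 : w ≠ 0) {q : K}
    (hq : w ^ 2 = algebraMap K (AlgebraicClosure K) q)
    (hw : ∀ σ ∈ levelFixing a c n, σ w = w) :
    ∃ S ⊆ Finset.range n, ∃ x : K,
      w * ∏ i ∈ S, critRoot a c i = algebraMap K (AlgebraicClosure K) x := by
  induction n generalizing w q with
  | zero =>
    have hfix : ∀ σ : Gal(AlgebraicClosure K/K), σ w = w := fun σ => hw σ fun β hβ => by
      rw [mem_levelSet_zero.1 hβ, AlgEquiv.commutes]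
    obtain ⟨x, hx⟩ := (InfiniteGalois.mem_range_algebraMap_iff_fixed w).2 hfix
    exact ⟨∅, subset_rfl, x, by simp [hx]⟩
  | succ n ih =>
    obtain ⟨t, ht⟩ := exists_galSign_eq_mul h (fun k hk => hE k (by omega)) hw0 hq hw
    have hE' : ∀ k < n, RealizesSigns a c k := fun k hk => hE k (by omega)
    rcases zmod_two_cases t with rfl | rfl
    · obtain ⟨S, hS, x, hx⟩ := ih hE' hw0 hq fun σ hσ => by
        rw [← galSign_eq_zero_iff, ht σ hσ, zero_mul]
      exact ⟨S, hS.trans (Finset.range_mono n.le_succ), x, hx⟩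
    · have hD := critRoot_ne_zero h n
      obtain ⟨S, hS, x, hx⟩ := ih (w := w * critRoot a c n) hE' (mul_ne_zero hw0 hD)
        (by rw [mul_pow, hq, critRoot_sq h, ← map_mul]) fun σ hσ => by
          have h1 := ht σ hσ
          rw [one_mul] at h1
          rw [map_mul, apply_eq_signOf (apply_eq_or_neg_of_sq hq σ),
            apply_eq_signOf (apply_eq_or_neg_of_sq (critRoot_sq h n) σ), h1, mul_mul_mul_comm,
            ← signOf_add, CharTwo.add_self_eq_zero]
          simp [signOf]
      have hn : n ∉ S := fun hn => by simpa using hS hn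
      refine ⟨insert n S, ?_, x, ?_⟩
      · rw [Finset.range_add_one]
        exact Finset.insert_subset_insert n hS
      · rw [Finset.prod_insert hn, ← mul_assoc, hx]

/-- The permutation action of the Galois group on level `n`. -/
noncomputable def levelPerm (a c : K) (n : ℕ) :
    Gal(AlgebraicClosure K/K) →* Equiv.Perm (levelSet a c n) where
  toFun σ :=
    { toFun := fun β => ⟨σ β, map_mem_levelSet σ β.2⟩
      invFun := fun β => ⟨σ.symm β, map_mem_levelSet σ.symm β.2⟩
      left_inv := fun β => Subtype.ext (σ.symm_apply_apply β)
      right_inv := fun β => Subtype.ext (σ.apply_symm_apply β) }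
  map_one' := rfl
  map_mul' _ _ := rfl

lemma pow_two_pow_mem_levelFixing (a c : K) (n : ℕ) (σ : Gal(AlgebraicClosure K/K)) :
    σ ^ 2 ^ n ∈ levelFixing a c n := by
  induction n with
  | zero =>
    intro β hβ
    rw [mem_levelSet_zero.1 hβ, AlgEquiv.commutes]
  | succ n ih =>
    intro β hβ
    rw [pow_succ, pow_mul, pow_two, AlgEquiv.mul_apply]
    rcases apply_eq_or_neg_of_polyMap (ih _ (mem_levelSet_succ.1 hβ)) with h | h
    · rw [h, h]
    · rw [h, map_neg, h, neg_neg]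

/-- The tower of levels is as large as possible once the discriminants `critDisc a c n` are
independent modulo squares. -/
theorem realizesSigns [CharZero K] {a c : K}
    (hind : ∀ n, ∀ S ⊆ Finset.range n,
      ¬ IsSquare (critDisc a c n * ∏ i ∈ S, critDisc a c i))
    (h : CriticalFree a c) (n : ℕ) : RealizesSigns a c n := by
  classical
  induction n using Nat.strong_induction_on with
  | _ n hE =>
  -- some automorphism over level `n` moves `critRoot a c n`
  obtain ⟨τ, hτ, hτD⟩ : ∃ τ ∈ levelFixing a c n, τ (critRoot a c n) ≠ critRoot a c n := by
    by_contra! hfix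
    obtain ⟨S, hS, x, hx⟩ := exists_mul_prod_critRoot_eq h n hE (critRoot_ne_zero h n)
      (critRoot_sq h n) hfix
    refine hind n S hS ⟨x, (algebraMap K (AlgebraicClosure K)).injective ?_⟩
    rw [map_mul, map_mul, ← hx, map_prod, ← critRoot_sq h n,
      Finset.prod_congr rfl fun i _ => (critRoot_sq h i).symm, Finset.prod_pow]
    ring
  let V : Submodule (ZMod 2) (levelSet a c n → ZMod 2) :=
    { carrier := {v | ∃ σ ∈ levelFixing a c n, ∀ β, galSign (sqrtSub c β.1) σ = v β}
      zero_mem' := ⟨1, one_mem _, fun β => galSign_one _⟩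
      add_mem' := by
        rintro v w ⟨σ, hσ, hv⟩ ⟨τ, hτ, hw⟩
        refine ⟨σ * τ, mul_mem hσ hτ, fun β => ?_⟩
        rw [galSign_mul (sqrtSub_ne_zero h β.2) (apply_sqrtSub hσ β.2) (apply_sqrtSub hτ β.2),
          hv, hw, Pi.add_apply]
      smul_mem' := by
        rintro x v hv
        rcases zmod_two_cases x with rfl | rfl
        · rw [zero_smul]
          exact ⟨1, one_mem _, fun β => galSign_one _⟩
        · rwa [one_smul] }
  have hV : V = ⊤ := by
    refine submodule_eq_top_of_transitive (levelPerm a c n) ?_ ?_ V ?_ ?_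
    · intro β γ
      obtain ⟨σ, hσ⟩ := exists_apply_eq_of_realizesSigns n hE β.2 γ.2
      exact ⟨σ, Subtype.ext hσ⟩
    · intro σ
      refine ⟨n, ?_⟩
      rw [← map_pow]
      exact Equiv.ext fun β => Subtype.ext (pow_two_pow_mem_levelFixing a c n σ β β.2)
    · rintro g v ⟨σ, hσ, hv⟩
      refine ⟨g⁻¹ * σ * g, conj_mem_levelFixing hσ g, fun β => ?_⟩
      rw [galSign_sqrtSub_conj]
      exact hv (levelPerm a c n g β)
    · refine ⟨fun β => galSign (sqrtSub c β.1) τ, ⟨τ, hτ, fun _ => rfl⟩, ?_⟩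
      rw [Finset.sum_coe_sort (levelSet a c n) fun β => galSign (sqrtSub c β) τ,
        ← galSign_critRoot h hτ, Ne, galSign_eq_zero_iff]
      exact hτD
  intro v
  obtain ⟨σ, hσ, hv⟩ : (fun β : levelSet a c n => v β) ∈ V := hV ▸ Submodule.mem_top
  exact ⟨σ, hσ, fun β hβ => hv ⟨β, hβ⟩⟩

/-! ### Surjectivity onto the automorphism group of the tree -/

lemma exists_galois_eq_on_level [CharZero K] {a c : K} (h : CriticalFree a c)
    (hE : ∀ n, RealizesSigns a c n)
    (φ : backwardTree (X ^ 2 + C c) a ≃g backwardTree (X ^ 2 + C c) a)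
    (hφ : φ (backwardRoot (X ^ 2 + C c) a) = backwardRoot (X ^ 2 + C c) a) (n : ℕ) :
    ∃ σ : Gal(AlgebraicClosure K/K), ∀ u : BackwardOrbit (X ^ 2 + C c) a,
      u.level = n → σ u.val = (φ u).val := by
  classical
  induction n with
  | zero =>
    refine ⟨1, fun u hu => ?_⟩
    rw [BackwardOrbit.eq_root_of_level hu, hφ]
    rfl
  | succ n ih =>
    obtain ⟨σ, hσ⟩ := ih
    obtain ⟨τ, hτ, hτv⟩ := hE n fun β =>
      if hβ : β ∈ levelSet a c n then
        if σ (sqrtSub c β) = (φ (nodeOfMem (sqrtSub_mem_levelSet hβ))).val then 0 else 1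
      else 0
    have hpar (u : BackwardOrbit (X ^ 2 + C c) a) (hu : u.level = n + 1) :
        (φ u).val = σ u.val ∨ (φ u).val = -σ u.val := by
      rw [← polyMap_eq_iff c, polyMap_apply_val φ hφ u hu, polyMap_galois]
      exact (hσ (u.parent hu) rfl).symm
    have hroot (β : AlgebraicClosure K) (hβ : β ∈ levelSet a c n) :
        (σ * τ) (sqrtSub c β) = (φ (nodeOfMem (sqrtSub_mem_levelSet hβ))).val := by
      have h1 := hτv β hβ
      rw [dif_pos hβ] at h1
      rw [AlgEquiv.mul_apply, apply_eq_signOf (apply_sqrtSub hτ hβ), h1]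
      split_ifs with h2
      · simpa [signOf] using h2
      · have h3 : (φ (nodeOfMem (sqrtSub_mem_levelSet hβ))).val = σ (sqrtSub c β) ∨
          (φ (nodeOfMem (sqrtSub_mem_levelSet hβ))).val = -σ (sqrtSub c β) := hpar _ rfl
        rw [h3.resolve_left fun h4 => h2 h4.symm]
        simp [signOf]
    refine ⟨σ * τ, fun u hu => ?_⟩
    have hβ : polyMap (X ^ 2 + C c) u.val ∈ levelSet a c n :=
      mem_levelSet_succ.1 (hu ▸ u.val_mem_levelSet)
    have h1 := hroot _ hβ
    set u' : BackwardOrbit (X ^ 2 + C c) a := nodeOfMem (sqrtSub_mem_levelSet hβ) with hu'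
    rcases (polyMap_eq_iff_sqrtSub c).1 (rfl : polyMap (X ^ 2 + C c) u.val = _) with h2 | h2
    · have : u = u' := BackwardOrbit.ext hu h2
      rw [this, ← h1]; rfl
    · -- `u` is the sibling of `u'`, and `φ` sends siblings to siblings
      have hne : u ≠ u' := fun h3 => by
        have h4 : u.val = sqrtSub c (polyMap (X ^ 2 + C c) u.val) := congrArg BackwardOrbit.val h3
        exact sqrtSub_ne_neg h hβ (h4.symm.trans h2)
      have hpp : u.parent hu = u'.parent rfl := BackwardOrbit.ext rfl (by
        change polyMap _ u.val = polyMap _ (sqrtSub c _)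
        rw [polyMap_sqrtSub])
      have h3 : polyMap (X ^ 2 + C c) (φ u).val = polyMap (X ^ 2 + C c) (φ u').val := by
        rw [polyMap_apply_val φ hφ u hu, polyMap_apply_val φ hφ u' rfl, hpp]
      rcases (polyMap_eq_iff c).1 h3 with h4 | h4
      · refine absurd (φ.injective (BackwardOrbit.ext ?_ h4)) hne
        rw [level_apply φ hφ, level_apply φ hφ, hu]; rfl
      · rw [h4, ← h1]
        conv_lhs => rw [h2]
        rw [map_neg]

lemma isClosed_setOf_apply_eq [CharZero K] (x y : AlgebraicClosure K) :
    IsClosed {σ : Gal(AlgebraicClosure K/K) | σ x = y} := by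
  by_cases h : ∃ τ : Gal(AlgebraicClosure K/K), τ x = y
  · obtain ⟨τ, rfl⟩ := h
    have h1 : IsClosed (MulAction.stabilizer Gal(AlgebraicClosure K/K) x :
        Set Gal(AlgebraicClosure K/K)) :=
      Subgroup.isClosed_of_isOpen _ (stabilizer_isOpen_of_isIntegral x)
    convert h1.preimage (continuous_const_mul τ⁻¹) using 1
    ext σ
    simp only [Set.mem_ofPred_eq, Set.mem_preimage, SetLike.mem_coe, MulAction.mem_stabilizer_iff,
      mul_smul, inv_smul_eq_iff]
    rfl
  · convert isClosed_empty
    exact Set.eq_empty_of_forall_notMem fun σ hσ => h ⟨σ, hσ⟩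

/-- If all sign patterns are realized, the arboreal representation is surjective: each finite level
is a successive choice of signs, and the Galois group is compact. -/
theorem arborealRepresentation_surjective_of_realizesSigns [CharZero K] {a c : K}
    (h : CriticalFree a c) (hE : ∀ n, RealizesSigns a c n) :
    Function.Surjective (arborealRepresentation (X ^ 2 + C c) a) := by
  rintro ⟨φ, hφ⟩
  let t : ℕ → Set Gal(AlgebraicClosure K/K) := fun n =>
    {σ | ∀ u : BackwardOrbit (X ^ 2 + C c) a, u.level = n → σ u.val = (φ u).val}
  have hcl : ∀ n, IsClosed (t n) := fun n => by
    simp only [t, Set.ofPred_forall]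
    exact isClosed_iInter fun u => isClosed_iInter fun _ => isClosed_setOf_apply_eq _ _
  obtain ⟨σ, hσ⟩ := IsCompact.nonempty_iInter_of_sequence_nonempty_isCompact_isClosed t
    (fun n σ hσ u hu => by
      let v : BackwardOrbit (X ^ 2 + C c) a :=
        nodeOfMem (sqrtSub_mem_levelSet u.val_mem_levelSet)
      have hv : v.level = u.level + 1 := rfl
      have hp : v.parent hv = u := BackwardOrbit.ext rfl (polyMap_sqrtSub c u.val)
      rw [← hp, ← polyMap_apply_val φ hφ v hv, ← hσ v (by omega), polyMap_galois]
      rfl)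
    (exists_galois_eq_on_level h hE φ hφ) (hcl 0).isCompact hcl
  refine ⟨σ, Subtype.ext (RelIso.ext fun u => BackwardOrbit.ext ?_ ?_)⟩
  · exact (level_apply φ hφ u).symm
  · exact Set.mem_iInter.1 hσ u.level u rfl

/-- Stoll's criterion: if no product of the discriminants `critDisc a c n` over a nonempty finite
set of indices is a square, the backward orbit of `a` is a regular binary tree and the arboreal
representation is surjective. -/
theorem arborealRepresentation_surjective_of_not_isSquare [CharZero K] {a c : K}
    (hind : ∀ n, ∀ S ⊆ Finset.range n,
      ¬ IsSquare (critDisc a c n * ∏ i ∈ S, critDisc a c i)) :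
    (∃ e : backwardTree (X ^ 2 + C c) a ≃g regularTree 2,
      e (backwardRoot (X ^ 2 + C c) a) = []) ∧
    Function.Surjective (arborealRepresentation (X ^ 2 + C c) a) := by
  have h : CriticalFree a c := fun n hn => hind n ∅ (Finset.empty_subset _) (by
    simp only [critDisc, hn, sub_self, mul_zero, zero_mul, IsSquare.zero])
  exact ⟨exists_backwardTree_iso h,
    arborealRepresentation_surjective_of_realizesSigns h (realizesSigns hind h)⟩

end Galois

/-! ### Arithmetic of the discriminants -/

/-- The numerator of `f^{n+1}(0)` over the denominator `s ^ 2 ^ (n + 1)`, where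
`f = x ^ 2 - 1 + a - a ^ 2` and `a = r / s`. -/
def orbitNum (r s : ℤ) : ℕ → ℤ
  | 0 => -(r ^ 2 - r * s + s ^ 2)
  | n + 1 => orbitNum r s n ^ 2 - (r ^ 2 - r * s + s ^ 2) * s ^ (2 ^ (n + 2) - 2)

/-- The numerator of `a - f^{n+1}(0)` over the denominator `s ^ 2 ^ (n + 1)`. -/
def gapNum (r s : ℤ) (n : ℕ) : ℤ := r * s ^ (2 ^ (n + 1) - 1) - orbitNum r s n

lemma gapNum_zero (r s : ℤ) : gapNum r s 0 = r ^ 2 + s ^ 2 := by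
  simp only [gapNum, orbitNum]; ring

section Field

variable {k : Type*} [Field k] {r s : ℤ}

lemma iterate_mul_pow_eq_orbitNum (hs : (s : k) ≠ 0) {a c : k} (ha : a = r / s)
    (hc : c = -1 + a - a ^ 2) (n : ℕ) :
    (fun y => y ^ 2 + c)^[n + 1] 0 * (s : k) ^ 2 ^ (n + 1) = orbitNum r s n := by
  have has : a * s = r := by rw [ha, div_mul_cancel₀ _ hs]
  have hcs : c * (s : k) ^ 2 = -(r ^ 2 - r * s + s ^ 2) := by
    rw [hc, ← has]; ring
  induction n with
  | zero => simpa [orbitNum] using hcs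
  | succ n ih =>
    have he : (s : k) ^ 2 ^ (n + 2) = (s : k) ^ (2 ^ (n + 2) - 2) * (s : k) ^ 2 := by
      rw [← pow_add, Nat.sub_add_cancel]
      exact Nat.le_self_pow (by omega) 2
    have he' : (s : k) ^ 2 ^ (n + 2) = ((s : k) ^ 2 ^ (n + 1)) ^ 2 := by
      rw [← pow_mul, ← pow_succ]
    rw [Function.iterate_succ_apply', add_mul]
    nth_rewrite 1 [he']
    rw [he, ← mul_pow, ih, orbitNum]
    push_cast
    linear_combination (s : k) ^ (2 ^ (n + 2) - 2) * hcs

lemma sub_iterate_mul_pow_eq_gapNum (hs : (s : k) ≠ 0) {a c : k} (ha : a = r / s)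
    (hc : c = -1 + a - a ^ 2) (n : ℕ) :
    (a - (fun y => y ^ 2 + c)^[n + 1] 0) * (s : k) ^ 2 ^ (n + 1) = gapNum r s n := by
  have has : a * s = r := by rw [ha, div_mul_cancel₀ _ hs]
  have he : (s : k) ^ 2 ^ (n + 1) = (s : k) ^ (2 ^ (n + 1) - 1) * s := by
    rw [← pow_succ, Nat.sub_add_cancel Nat.one_le_two_pow]
  rw [sub_mul, iterate_mul_pow_eq_orbitNum hs ha hc, gapNum, he]
  push_cast
  linear_combination (s : k) ^ (2 ^ (n + 1) - 1) * has

/-- The orbit of `a` is `a ↦ a - 1 ↦ -a ↦ a - 1`. -/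
lemma iterate_succ_eq_or {a c : k} (hc : c = -1 + a - a ^ 2) (j : ℕ) :
    (fun y => y ^ 2 + c)^[j + 1] a = a - 1 ∨ (fun y => y ^ 2 + c)^[j + 1] a = -a := by
  induction j with
  | zero => left; rw [Function.iterate_one, hc]; ring
  | succ j ih =>
    rw [Function.iterate_succ_apply']
    rcases ih with h | h <;> rw [h, hc]
    · right; ring
    · left; ring

/-- The orbit of `0` returns to `a` only if `2 * a = 0`, because the orbit of `a` is finite. -/
lemma two_mul_eq_zero_of_iterate_eq {a c : k} (hc : c = -1 + a - a ^ 2) {n m : ℕ} (hnm : n < m)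
    (hn : (fun y => y ^ 2 + c)^[n + 1] 0 = a) (hm : (fun y => y ^ 2 + c)^[m + 1] 0 = a) :
    2 * a = 0 := by
  obtain ⟨j, rfl⟩ := Nat.exists_eq_add_of_lt hnm
  rw [show n + j + 1 + 1 = (j + 1) + (n + 1) by omega, Function.iterate_add_apply, hn] at hm
  rcases iterate_succ_eq_or hc j with h | h <;> rw [h] at hm
  · exact absurd hm (by simp)
  · linear_combination -hm

end Field

section Ring

variable {R : Type*} [CommRing R] {r s : ℤ}

lemma orbitNum_succ_of_eq_zero (hs : (s : R) = 0) (n : ℕ) :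
    (orbitNum r s (n + 1) : R) = (r : R) ^ 2 ^ (n + 2) := by
  have he (n : ℕ) : 2 ^ (n + 2) - 2 ≠ 0 := by
    have := Nat.lt_pow_self (n := n + 2) (a := 2) (by norm_num)
    omega
  induction n with
  | zero => simp [orbitNum, hs, ← pow_mul]
  | succ n ih =>
    rw [orbitNum]
    push_cast
    rw [ih, hs, zero_pow (he (n + 1)), mul_zero, sub_zero, ← pow_mul, ← pow_succ]

lemma gapNum_succ_of_eq_zero (hs : (s : R) = 0) (n : ℕ) :
    (gapNum r s (n + 1) : R) = -(r : R) ^ 2 ^ (n + 2) := by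
  have he : 2 ^ (n + 2) - 1 ≠ 0 := by
    have := Nat.lt_pow_self (n := n + 2) (a := 2) (by norm_num)
    omega
  rw [gapNum]
  push_cast
  rw [orbitNum_succ_of_eq_zero hs, hs, zero_pow he, mul_zero, zero_sub]

end Ring

/-- A common prime divisor of two of the numerators `gapNum r s n` divides `2 * r`. -/
lemma dvd_of_dvd_gapNum {r s : ℤ} (hrs : Int.gcd r s = 1) {p : ℕ} (hp : p.Prime) {n m : ℕ}
    (hnm : n < m) (hn : (p : ℤ) ∣ gapNum r s n) (hm : (p : ℤ) ∣ gapNum r s m) :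
    (p : ℤ) ∣ 2 * r := by
  have : Fact p.Prime := ⟨hp⟩
  rw [← ZMod.intCast_zmod_eq_zero_iff_dvd] at hn hm
  have hs : (s : ZMod p) ≠ 0 := fun hs => by
    obtain ⟨m, rfl⟩ := Nat.exists_eq_succ_of_ne_zero (Nat.ne_zero_of_lt hnm)
    rw [Nat.succ_eq_add_one, gapNum_succ_of_eq_zero hs, neg_eq_zero] at hm
    have hr := eq_zero_of_pow_eq_zero hm
    rw [ZMod.intCast_zmod_eq_zero_iff_dvd] at hr hs
    have := Int.dvd_coe_gcd hr hs
    rw [hrs] at this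
    exact hp.one_lt.ne' (by exact_mod_cast Int.eq_one_of_dvd_one (by positivity) this)
  set a : ZMod p := r / s with ha
  have key (n : ℕ) (h : ((gapNum r s n : ℤ) : ZMod p) = 0) :
      (fun y => y ^ 2 + (-1 + a - a ^ 2))^[n + 1] 0 = a := by
    rw [← sub_iterate_mul_pow_eq_gapNum hs ha rfl] at h
    exact (sub_eq_zero.1 ((mul_eq_zero.1 h).resolve_right (pow_ne_zero _ hs))).symm
  have h := two_mul_eq_zero_of_iterate_eq rfl hnm (key n hn) (key m hm)
  rw [← ZMod.intCast_zmod_eq_zero_iff_dvd]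
  push_cast
  have has : a * s = r := by rw [ha, div_mul_cancel₀ _ hs]
  linear_combination (s : ZMod p) * h - 2 * has

lemma odd_pow_cast_zmod_eight {s : ZMod 8} (hs : s ^ 2 = 1) (n : ℕ) :
    s ^ (2 ^ (n + 1) - 1) = s ∧ s ^ (2 ^ (n + 2) - 2) = 1 := by
  have h1 : 2 ^ (n + 1) - 1 = 2 * (2 ^ n - 1) + 1 := by
    have := Nat.one_le_two_pow (n := n)
    rw [pow_succ]; omega
  have h2 : 2 ^ (n + 2) - 2 = 2 * (2 ^ (n + 1) - 1) := by
    rw [pow_succ 2 (n + 1)]; omega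
  rw [h1, h2, pow_succ, pow_mul, pow_mul, hs, one_pow, one_pow, one_mul]
  exact ⟨rfl, rfl⟩

lemma orbitNum_two_zmod_eight {s : ℤ} (hs : (s : ZMod 8) ^ 2 = 1) (k : ℕ) :
    (orbitNum 2 s (2 * k + 1) : ZMod 8) = -2 * s ∧
      (orbitNum 2 s (2 * k + 2) : ZMod 8) = 2 * s - 1 := by
  have step (n : ℕ) : (orbitNum 2 s (n + 1) : ZMod 8) =
      (orbitNum 2 s n : ZMod 8) ^ 2 - (5 - 2 * s) := by
    rw [orbitNum]
    push_cast
    rw [(odd_pow_cast_zmod_eight hs n).2, hs]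
    ring
  have h8 : (8 : ZMod 8) = 0 := by decide
  have hodd (n : ℕ) (h : (orbitNum 2 s n : ZMod 8) = -2 * s) :
      (orbitNum 2 s (n + 1) : ZMod 8) = 2 * s - 1 := by
    rw [step, h]; linear_combination 4 * hs
  have heven (n : ℕ) (h : (orbitNum 2 s n : ZMod 8) = 2 * s - 1) :
      (orbitNum 2 s (n + 1) : ZMod 8) = -2 * s := by
    rw [step, h]; linear_combination 4 * hs
  have h1 : (orbitNum 2 s 1 : ZMod 8) = -2 * s := by
    rw [step]
    simp only [orbitNum]
    push_cast
    linear_combination (s ^ 2 + 13 - 4 * s : ZMod 8) * hs + (3 - 2 * s : ZMod 8) * h8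
  induction k with
  | zero => exact ⟨h1, hodd 1 h1⟩
  | succ k ih =>
    have h2 := heven _ ih.2
    exact ⟨h2, hodd _ h2⟩

/-- The 2-adic valuation of `gapNum r s n` is `0` or `2`. -/
lemma exists_odd_gapNum {r s : ℤ} (hrs : Int.gcd r s = 1) (hr : r = 1 ∧ Even s ∨ r = 2) (n : ℕ) :
    ∃ m : ℤ, Odd m ∧ (gapNum r s n = m ∨ gapNum r s n = 2 ^ 2 * m) := by
  rcases hr with ⟨rfl, hs⟩ | rfl
  · refine ⟨_, ?_, Or.inl rfl⟩
    have hs2 : (s : ZMod 2) = 0 := (ZMod.intCast_eq_zero_iff_even).2 hs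
    rw [← ZMod.intCast_eq_one_iff_odd]
    cases n with
    | zero => rw [gapNum_zero]; simp [hs2]
    | succ n => rw [gapNum_succ_of_eq_zero hs2]; simp
  · have hs : Odd s := by
      rw [← Int.not_even_iff_odd]
      intro hs
      have := Int.dvd_coe_gcd (dvd_refl (2 : ℤ)) hs.two_dvd
      rw [hrs] at this
      norm_num at this
    have hs8 : (s : ZMod 8) ^ 2 = 1 := by
      have h1 : (8 : ℤ) ∣ s ^ 2 - 1 := Int.eight_dvd_sq_sub_one_of_odd hs
      have := (ZMod.intCast_zmod_eq_zero_iff_dvd (s ^ 2 - 1) 8).2 (by exact_mod_cast h1)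
      push_cast at this
      exact sub_eq_zero.1 this
    have hgap (n : ℕ) : (gapNum 2 s n : ZMod 8) = 2 * s - orbitNum 2 s n := by
      rw [gapNum]
      push_cast
      rw [(odd_pow_cast_zmod_eight hs8 n).1]
    obtain ⟨t, ht⟩ := hs
    rcases n.even_or_odd' with ⟨k, rfl | rfl⟩
    · refine ⟨_, ?_, Or.inl rfl⟩
      cases k with
      | zero => rw [mul_zero, gapNum_zero, ht]; exact ⟨2 * t ^ 2 + 2 * t + 2, by ring⟩
      | succ k =>
        have h1 := hgap (2 * k + 2)
        rw [(orbitNum_two_zmod_eight hs8 k).2, sub_sub_cancel] at h1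
        have h2 : ((gapNum 2 s (2 * k + 2) : ℤ) : ZMod 8) = ((1 : ℤ) : ZMod 8) := by
          rw [h1]; simp
        rw [ZMod.intCast_eq_intCast_iff_dvd_sub] at h2
        obtain ⟨j, hj⟩ := h2
        push_cast at hj
        exact ⟨-(4 * j), by rw [mul_add, mul_one]; linarith⟩
    · have h1 := hgap (2 * k + 1)
      rw [(orbitNum_two_zmod_eight hs8 k).1] at h1
      have h2 : ((gapNum 2 s (2 * k + 1) : ℤ) : ZMod 8) = ((4 * s : ℤ) : ZMod 8) := by
        rw [h1]; push_cast; ring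
      rw [ZMod.intCast_eq_intCast_iff_dvd_sub] at h2
      obtain ⟨j, hj⟩ := h2
      push_cast at hj
      exact ⟨s - 2 * j, ⟨t - j, by rw [ht]; ring⟩, Or.inr (by linarith)⟩

/-- `gapNum r s n` is not a square: this is seen modulo `4`, `3` and `q` respectively. -/
lemma not_isSquare_gapNum {r s : ℤ} (h0 : ¬ IsSquare (r ^ 2 + s ^ 2))
    (h : (r = 1 ∧ 2 < s ∧ Even s) ∨ (r = 2 ∧ 3 < s ∧ s ≡ 1 [ZMOD 3]) ∨
      (r = 2 ∧ ∃ q : ℕ, q.Prime ∧ q ≡ 3 [MOD 4] ∧ (q : ℤ) ∣ s)) (n : ℕ) :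
    ¬ IsSquare (gapNum r s n) := by
  cases n with
  | zero => rwa [gapNum_zero]
  | succ n =>
    intro hsq
    rcases h with ⟨rfl, -, t, ht⟩ | ⟨rfl, -, hs⟩ | ⟨rfl, q, hq, hq4, hqs⟩
    · have h4 : (4 : ZMod 4) = 0 := by decide
      have hst : (s : ZMod 4) = 2 * t := by rw [ht]; push_cast; ring
      have hs2 : (s : ZMod 4) ^ 2 = 0 := by rw [hst]; linear_combination (t : ZMod 4) ^ 2 * h4
      have hbig (j : ℕ) : 2 + 2 ≤ 2 ^ (j + 2) := by
        rw [pow_add]; have := Nat.one_le_two_pow (n := j); omega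
      have horb : ∀ j, (orbitNum 1 s j : ZMod 4) ^ 2 = 1 := by
        intro j
        induction j with
        | zero =>
          simp only [orbitNum]
          push_cast
          linear_combination (s ^ 2 + 3 - 2 * s : ZMod 4) * hs2 - 2 * hst - (t : ZMod 4) * h4
        | succ j ih =>
          rw [orbitNum]
          push_cast
          rw [ih, pow_eq_zero_of_le (Nat.le_sub_of_add_le (hbig j)) hs2]
          ring
      have hg : (gapNum 1 s (n + 1) : ZMod 4) = -1 := by
        rw [gapNum, orbitNum]
        push_cast
        rw [horb, pow_eq_zero_of_le (Nat.le_sub_of_add_le (hbig n)) hs2,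
          pow_eq_zero_of_le (Nat.le_sub_of_add_le ((by omega : 2 + 1 ≤ 2 + 2).trans (hbig n))) hs2]
        ring
      obtain ⟨y, hy⟩ := hsq
      rw [hy] at hg
      push_cast at hg
      exact (by decide : ∀ y : ZMod 4, y * y ≠ -1) _ hg
    · have hs1 : (s : ZMod 3) = 1 := by
        have := (ZMod.intCast_eq_intCast_iff s 1 3).2 hs
        simpa using this
      have h3 : (3 : ZMod 3) = 0 := by decide
      have horb : ∀ j, (orbitNum 2 s j : ZMod 3) = 0 := by
        intro j
        induction j with
        | zero =>
          simp only [orbitNum]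
          push_cast
          rw [hs1]
          linear_combination -h3
        | succ j ih =>
          rw [orbitNum]
          push_cast
          rw [ih, hs1, one_pow]
          linear_combination -h3
      obtain ⟨y, hy⟩ := hsq
      have hg : ((gapNum 2 s (n + 1) : ℤ) : ZMod 3) = 2 := by
        rw [gapNum]
        push_cast
        rw [horb, hs1]
        ring
      rw [hy] at hg
      push_cast at hg
      exact (by decide : ∀ y : ZMod 3, y * y ≠ 2) _ hg
    · have : Fact q.Prime := ⟨hq⟩
      have hs0 : (s : ZMod q) = 0 := (ZMod.intCast_zmod_eq_zero_iff_dvd s q).2 hqs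
      have h2 : (2 : ZMod q) ≠ 0 := fun h2 => by
        have h3 : q ∣ 2 := (ZMod.natCast_eq_zero_iff 2 q).1 (by exact_mod_cast h2)
        have h4 := (Nat.prime_dvd_prime_iff_eq hq Nat.prime_two).1 h3
        rw [h4] at hq4
        exact absurd hq4 (by decide)
      obtain ⟨y, hy⟩ := hsq
      have hg := gapNum_succ_of_eq_zero (r := 2) hs0 n
      rw [hy] at hg
      push_cast at hg
      have hsq1 : IsSquare (-1 : ZMod q) := by
        refine ⟨y / 2 ^ 2 ^ (n + 1), ?_⟩
        have h5 : (2 : ZMod q) ^ 2 ^ (n + 2) = 2 ^ 2 ^ (n + 1) * 2 ^ 2 ^ (n + 1) := by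
          rw [← pow_add, ← two_mul, ← pow_succ']
        rw [div_mul_div_comm, hg, ← h5, neg_div, div_self (pow_ne_zero _ h2)]
      exact ZMod.exists_sq_eq_neg_one_iff.1 hsq1 hq4

/-- For `0 ≤ a ≤ 1` the orbit of `0` stays in the interval `[c, 0]`. -/
lemma iterate_zero_mem_Icc {a c : ℚ} (hc : c = -1 + a - a ^ 2) (ha0 : 0 ≤ a) (ha1 : a ≤ 1)
    (n : ℕ) : (fun y => y ^ 2 + c)^[n + 1] 0 ∈ Set.Icc c 0 := by
  have hc0 : c ≤ 0 := by nlinarith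
  have hc1 : -1 ≤ c := by nlinarith
  induction n with
  | zero => simpa using hc0
  | succ n ih =>
    rw [Function.iterate_succ_apply']
    generalize (fun y => y ^ 2 + c)^[n + 1] 0 = x at ih
    obtain ⟨h1, h2⟩ := ih
    exact ⟨by nlinarith, by nlinarith⟩

/-- A product of an integer `m₀ > 0` with integers `m i` coprime to it is not a square, even up to
rational squares, unless `m₀` is a square. -/
lemma not_isSquare_mul_prod {ι : Type*} {S : Finset ι} {m₀ : ℤ} {m : ι → ℤ} (hpos : 0 < m₀)
    (hsq : ¬ IsSquare m₀) (hcop : ∀ i ∈ S, IsCoprime m₀ (m i)) :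
    ¬ IsSquare (m₀ * ∏ i ∈ S, m i) := by
  rintro ⟨y, hy⟩
  obtain ⟨x, hx | hx⟩ := Int.sq_of_isCoprime (IsCoprime.prod_right hcop) (hy.trans (sq y).symm)
  · exact hsq ⟨x, hx.trans (sq x)⟩
  · nlinarith [sq_nonneg x]

lemma not_isSquare_critDisc_mul_prod {a c : ℚ} {r s : ℤ} (hs : 0 < s) (hrs : Int.gcd r s = 1)
    (ha : a = (r : ℚ) / (s : ℚ)) (hc : c = -1 + a - a ^ 2) (hr : r = 1 ∧ Even s ∨ r = 2)
    (hrs' : r ≤ s) (hsq : ∀ n, ¬ IsSquare (gapNum r s n)) (n : ℕ) (S : Finset ℕ)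
    (hS : S ⊆ Finset.range n) : ¬ IsSquare (critDisc a c n * ∏ i ∈ S, critDisc a c i) := by
  have hsQ : (0 : ℚ) < s := by exact_mod_cast hs
  have hr0 : 0 < r := by rcases hr with ⟨rfl, -⟩ | rfl <;> norm_num
  have hrQ : (0 : ℚ) < r := by exact_mod_cast hr0
  have ha0 : 0 < a := by rw [ha]; positivity
  have ha1 : a ≤ 1 := by rw [ha, div_le_one hsQ]; exact_mod_cast hrs'
  have hgap (n : ℕ) := sub_iterate_mul_pow_eq_gapNum hsQ.ne' ha hc n
  have hIcc (n : ℕ) := iterate_zero_mem_Icc hc ha0.le ha1 n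
  have hgpos (n : ℕ) : 0 < gapNum r s n := by
    have h1 : 0 < a - (fun y => y ^ 2 + c)^[n + 1] 0 := by linarith [(hIcc n).2]
    have h2 : (0 : ℚ) < gapNum r s n := by
      rw [← hgap n]; positivity
    exact_mod_cast h2
  choose m hodd hm using exists_odd_gapNum hrs hr
  have hmdvd (n : ℕ) : m n ∣ gapNum r s n := by
    rcases hm n with h | h <;> rw [h]
    exact dvd_mul_left _ _
  have hmpos (n : ℕ) : 0 < m n := by
    have := hgpos n
    rcases hm n with h | h <;> rw [h] at this
    · exact this
    · linarith
  have hmsq (n : ℕ) : ¬ IsSquare (m n) := fun h => hsq n (by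
    rcases hm n with h' | h' <;> rw [h']
    · exact h
    · exact (IsSquare.sq 2).mul h)
  have hcop (i : ℕ) (hi : i < n) : IsCoprime (m n) (m i) := by
    rw [Int.isCoprime_iff_gcd_eq_one, Int.gcd_eq_natAbs]
    by_contra hne
    obtain ⟨p, hp, hpn, hpi⟩ := Nat.Prime.not_coprime_iff_dvd.1 hne
    rw [← Int.natCast_dvd] at hpn hpi
    have h1 := dvd_of_dvd_gapNum hrs hp hi (hpi.trans (hmdvd i)) (hpn.trans (hmdvd n))
    have h2 : (p : ℤ) ∣ 2 ^ 2 := h1.trans (by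
      rcases hr with ⟨rfl, -⟩ | rfl <;> norm_num)
    have h3 : p ∣ 2 := hp.dvd_of_dvd_pow (by exact_mod_cast h2)
    rw [(Nat.prime_dvd_prime_iff_eq hp Nat.prime_two).1 h3] at hpn
    exact (Int.not_even_iff_odd.2 (hodd n)) (even_iff_two_dvd.2 hpn)
  -- up to rational squares, `|critDisc a c n|` is `m n`
  have habs (n : ℕ) : ∃ z : ℚ, z ≠ 0 ∧ |critDisc a c n| = m n * z ^ 2 := by
    have h1 : |critDisc a c n| = gapNum r s n * (((s : ℚ) ^ 2 ^ n)⁻¹) ^ 2 := by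
      rw [critDisc, abs_mul, abs_pow, abs_neg, abs_one, one_pow, one_mul, abs_sub_comm,
        abs_of_pos (by linarith [(hIcc n).2]), ← hgap n, pow_succ 2 n, pow_mul, inv_pow,
        mul_inv_cancel_right₀ (by positivity)]
    rcases hm n with h | h
    · exact ⟨_, by positivity, h ▸ h1⟩
    · refine ⟨2 * ((s : ℚ) ^ 2 ^ n)⁻¹, by positivity, ?_⟩
      rw [h1, h]; push_cast; ring
  choose z hz0 hz using habs
  intro h
  refine not_isSquare_mul_prod (hmpos n) (hmsq n)
    (fun i hi => hcop i (Finset.mem_range.1 (hS hi))) ?_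
  rw [← Rat.isSquare_intCast_iff]
  have h1 : critDisc a c n * ∏ i ∈ S, critDisc a c i =
      ((m n * ∏ i ∈ S, m i : ℤ) : ℚ) * (z n * ∏ i ∈ S, z i) ^ 2 := by
    rw [← abs_of_nonneg h.nonneg, abs_mul, Finset.abs_prod, hz,
      Finset.prod_congr rfl fun i _ => hz i, Finset.prod_mul_distrib, Finset.prod_pow]
    push_cast
    ring
  have hZ : z n * ∏ i ∈ S, z i ≠ 0 :=
    mul_ne_zero (hz0 n) (Finset.prod_ne_zero_iff.2 fun i _ => hz0 i)
  obtain ⟨y, hy⟩ := h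
  refine ⟨y / (z n * ∏ i ∈ S, z i), ?_⟩
  rw [div_mul_div_comm, ← hy, h1, ← sq, mul_div_cancel_right₀ _ (pow_ne_zero 2 hZ)]

theorem theorem1p2 (a c : ℚ) (r s : ℤ) (hs : 0 < s) (hrs : Int.gcd r s = 1)
    (ha : a = (r : ℚ) / (s : ℚ)) (hc : c = -1 + a - a ^ 2)
    (hsq : ¬ IsSquare (a - c))
    (h : (r = 1 ∧ 2 < s ∧ Even s) ∨
      (r = 2 ∧ 3 < s ∧ s ≡ 1 [ZMOD 3]) ∨
      (r = 2 ∧ ∃ q : ℕ, q.Prime ∧ q ≡ 3 [MOD 4] ∧ (q : ℤ) ∣ s)) :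
    -- the backward orbit of `a` is a regular binary rooted tree
    (∃ e : backwardTree (X ^ 2 + C c) a ≃g regularTree 2,
      e (backwardRoot (X ^ 2 + C c) a) = []) ∧
    -- and every automorphism of this rooted tree comes from the absolute Galois group of `ℚ`
    Function.Surjective (arborealRepresentation (X ^ 2 + C c) a) := by
  have hsQ : (s : ℚ) ≠ 0 := by exact_mod_cast hs.ne'
  have h0 : ¬ IsSquare (r ^ 2 + s ^ 2) := by
    rintro ⟨y, hy⟩
    refine hsq ⟨y / s, ?_⟩
    have hy' : (r : ℚ) ^ 2 + (s : ℚ) ^ 2 = y * y := by exact_mod_cast hy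
    rw [div_mul_div_comm, ← hy', hc, ha]
    field_simp
    ring
  have hr : r = 1 ∧ Even s ∨ r = 2 := by
    rcases h with ⟨h1, -, h2⟩ | ⟨h1, -⟩ | ⟨h1, -⟩
    · exact Or.inl ⟨h1, h2⟩
    · exact Or.inr h1
    · exact Or.inr h1
  have hle : r ≤ s := by
    rcases h with ⟨h1, h2, -⟩ | ⟨h1, h2, -⟩ | ⟨h1, q, -, hq4, hqs⟩
    · omega
    · omega
    · have h2 := Int.le_of_dvd hs hqs
      have h3 : q % 4 = 3 := hq4
      omega
  exact arborealRepresentation_surjective_of_not_isSquare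
    (not_isSquare_critDisc_mul_prod hs hrs ha hc hr hle (not_isSquare_gapNum h0 h))
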